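/- Let $q$ be a prime power and let $\mathrm{AG}(3,q)$ be the $3$-dimensional affine space over the finite field $\mathbb{F}_q$. A line spread of $\mathrm{AG}(3,q)$ is a set of pairwise disjoint (affine) lines that partitions the point set of $\mathrm{AG}(3,q)$. A Cameron–Liebler line class of $\mathrm{AG}(3,q)$ with parameter $x$ is a set $\mathcal{L}$ of lines of $\mathrm{AG}(3,q)$ such that $|\mathcal{L}\cap\mathcal{S}|=x$ for every line spread $\mathcal{S}$ of $\mathrm{AG}(3,q)$. If $\mathcal{L}$ is a Cameron–Liebler line class of $\mathrm{AG}(3,q)$ with parameter $x$, then $$\frac{x(x-1)}{2}\equiv 0 \pmod{q+1}.$$ -/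

import Mathlib

/-- An affine line: a nonempty affine subspace of dimension one. -/
def IsAffineLine {K V P : Type*} [Field K] [AddCommGroup V] [Module K V] [AddTorsor V P]
    (l : AffineSubspace K P) : Prop :=
  (l : Set P).Nonempty ∧ Module.finrank K l.direction = 1

/-- A line spread: a set of pairwise disjoint lines that partitions the points of the space. -/
structure IsAffineLineSpread {K V P : Type*} [Field K] [AddCommGroup V] [Module K V]
    [AddTorsor V P] (S : Set (AffineSubspace K P)) : Prop where
  isLine : ∀ l ∈ S, IsAffineLine l
  disjoint : ∀ l ∈ S, ∀ m ∈ S, l ≠ m → Disjoint (l : Set P) (m : Set P)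
  cover : ∀ p : P, ∃ l ∈ S, p ∈ l

/-- A Cameron–Liebler line class of parameter `x` of the affine space `P`: a set of lines that
meets every line spread in exactly `x` lines. -/
structure IsAffineCameronLiebler {K V P : Type*} [Field K] [AddCommGroup V] [Module K V]
    [AddTorsor V P] (L : Set (AffineSubspace K P)) (x : ℕ) : Prop where
  isLine : ∀ l ∈ L, IsAffineLine l
  encard_inter : ∀ S : Set (AffineSubspace K P), IsAffineLineSpread S → (L ∩ S).encard = x

section ParallelLines

open Submodule

variable {K V P : Type*} [Field K] [AddCommGroup V] [Module K V] [AddTorsor V P]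

/-! A parallel class is a spread, so `L` has exactly `x` lines in each direction. Switching
direction inside a plane `π` gives another spread (`isAffineLineSpread_switch`), so `L` has the same
number `n_π` of lines in `π` for each direction of `π`. Now count triples `(v, l, m)` with `v ≠ 0`
and `l ≠ m` lines of `L` along `v`. By vector there are `(q^3 - 1) * x * (x - 1)`; by the plane `l ⊔
m` there are `(q^2 - 1) * ∑ n_π * (n_π - 1)`. Cancelling `2 * (q - 1)`, `q + 1` divides `(q^2 + q +
1) * x.choose 2`, and `q^2 + q + 1 ≡ 1` modulo `q + 1`. -/

theorem AffineSubspace.eq_mk'_of_direction_eq {l : AffineSubspace K P} {W : Submodule K V} {p : P}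
    (hl : l.direction = W) (hp : p ∈ l) : l = AffineSubspace.mk' p W := by
  rw [← hl, AffineSubspace.mk'_eq hp]

theorem AffineSubspace.mk'_le_of_le_direction {π : AffineSubspace K P} {W : Submodule K V} {p : P}
    (hp : p ∈ π) (hW : W ≤ π.direction) : AffineSubspace.mk' p W ≤ π := by
  intro y hy
  have h := AffineSubspace.vadd_mem_of_mem_direction (hW (AffineSubspace.mem_mk'.1 hy)) hp
  simpa using h

/-- The lines with direction vector `v`. -/
def parallelClass (K P : Type*) {V : Type*} [Field K] [AddCommGroup V] [Module K V]
    [AddTorsor V P] (v : V) : Set (AffineSubspace K P) :=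
  {l | (l : Set P).Nonempty ∧ l.direction = span K {v}}

theorem mk'_mem_parallelClass (p : P) (v : V) :
    AffineSubspace.mk' p (span K {v}) ∈ parallelClass K P v :=
  ⟨⟨p, AffineSubspace.self_mem_mk' _ _⟩, AffineSubspace.direction_mk' _ _⟩

theorem eq_of_mem_parallelClass {v : V} {l m : AffineSubspace K P} {p : P}
    (hl : l ∈ parallelClass K P v) (hm : m ∈ parallelClass K P v) (hpl : p ∈ l) (hpm : p ∈ m) :
    l = m := by
  rw [AffineSubspace.eq_mk'_of_direction_eq hl.2 hpl, AffineSubspace.eq_mk'_of_direction_eq hm.2 hpm]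

theorem isAffineLine_of_mem_parallelClass {v : V} (hv : v ≠ 0) {l : AffineSubspace K P}
    (hl : l ∈ parallelClass K P v) : IsAffineLine l :=
  ⟨hl.1, by rw [hl.2, finrank_span_singleton hv]⟩

theorem le_of_mem_parallelClass {v : V} {l π : AffineSubspace K P} {p : P}
    (hl : l ∈ parallelClass K P v) (hv : v ∈ π.direction) (hpl : p ∈ l) (hp : p ∈ π) : l ≤ π := by
  rw [AffineSubspace.eq_mk'_of_direction_eq hl.2 hpl]
  exact AffineSubspace.mk'_le_of_le_direction hp (by simpa using hv)

theorem isAffineLineSpread_parallelClass {v : V} (hv : v ≠ 0) :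
    IsAffineLineSpread (parallelClass K P v) where
  isLine _ hl := isAffineLine_of_mem_parallelClass hv hl
  disjoint l hl m hm hne := by
    rw [Set.disjoint_left]
    exact fun p hpl hpm => hne (eq_of_mem_parallelClass hl hm hpl hpm)
  cover p := ⟨_, mk'_mem_parallelClass p v, AffineSubspace.self_mem_mk' _ _⟩

/-- Replacing, inside a flat `π`, the lines of direction `v` by those of direction `w` turns a
parallel class into another spread. -/
theorem isAffineLineSpread_switch {v w : V} (hv : v ≠ 0) (hw : w ≠ 0) {π : AffineSubspace K P}
    (hvπ : v ∈ π.direction) (hwπ : w ∈ π.direction) :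
    IsAffineLineSpread ({l | l ∈ parallelClass K P v ∧ ¬ l ≤ π} ∪
      {l | l ∈ parallelClass K P w ∧ l ≤ π}) where
  isLine := by
    rintro l (hl | hl)
    · exact isAffineLine_of_mem_parallelClass hv hl.1
    · exact isAffineLine_of_mem_parallelClass hw hl.1
  disjoint := by
    rintro l (hl | hl) m (hm | hm) hne <;> rw [Set.disjoint_left] <;> intro p hpl hpm
    · exact hne (eq_of_mem_parallelClass hl.1 hm.1 hpl hpm)
    · exact hl.2 (le_of_mem_parallelClass hl.1 hvπ hpl (hm.2 hpm))
    · exact hm.2 (le_of_mem_parallelClass hm.1 hvπ hpm (hl.2 hpl))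
    · exact hne (eq_of_mem_parallelClass hl.1 hm.1 hpl hpm)
  cover p := by
    by_cases hp : p ∈ π
    · refine ⟨_, Or.inr ⟨mk'_mem_parallelClass p w, ?_⟩, AffineSubspace.self_mem_mk' _ _⟩
      exact AffineSubspace.mk'_le_of_le_direction hp (by simpa using hwπ)
    · exact ⟨_, Or.inl ⟨mk'_mem_parallelClass p v,
        fun h => hp (h (AffineSubspace.self_mem_mk' _ _))⟩, AffineSubspace.self_mem_mk' _ _⟩

/-- Two distinct parallel lines span a plane. -/
theorem finrank_direction_sup_of_parallel {v : V} {l m : AffineSubspace K P} (hv : v ≠ 0)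
    (hl : l ∈ parallelClass K P v) (hm : m ∈ parallelClass K P v) (hne : l ≠ m) :
    Module.finrank K (l ⊔ m).direction = 2 := by
  obtain ⟨p, hp⟩ := hl.1
  obtain ⟨p', hp'⟩ := hm.1
  rw [AffineSubspace.direction_sup hp hp', hl.2, hm.2, sup_idem, ← span_union,
    Set.singleton_union]
  have hnot : p' -ᵥ p ∉ span K {v} := by
    intro h
    rw [← hl.2] at h
    have := AffineSubspace.vadd_mem_of_mem_direction h hp
    rw [vsub_vadd] at this
    exact hne (eq_of_mem_parallelClass hl hm this hp')
  have hli : LinearIndependent K ![v, p' -ᵥ p] := by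
    rw [LinearIndependent.pair_iff' hv]
    exact fun a ha => hnot (mem_span_singleton.2 ⟨a, ha⟩)
  have := finrank_span_eq_card hli
  rwa [Matrix.range_cons, Matrix.range_cons, Matrix.range_empty, Set.union_empty,
    Set.singleton_union, Fintype.card_fin] at this

/-- Equal dimensions force equality. This uniqueness assigns each pair of parallel lines to a single
plane in the double count. -/
theorem sup_eq_of_parallel_of_le {v : V} {l m π : AffineSubspace K P} (hv : v ≠ 0)
    (hl : l ∈ parallelClass K P v) (hm : m ∈ parallelClass K P v) (hne : l ≠ m)
    (hπ : Module.finrank K π.direction = 2) (hlπ : l ≤ π) (hmπ : m ≤ π) : l ⊔ m = π := by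
  have hle : l ⊔ m ≤ π := sup_le hlπ hmπ
  have : FiniteDimensional K π.direction := Module.finite_of_finrank_pos (by omega)
  refine AffineSubspace.eq_of_direction_eq_of_nonempty_of_le ?_ ?_ hle
  · refine Submodule.eq_of_le_of_finrank_eq (AffineSubspace.direction_le hle) ?_
    rw [hπ, finrank_direction_sup_of_parallel hv hl hm hne]
  · exact hl.1.mono (le_sup_left (a := l) (b := m))

end ParallelLines

section Counting

variable {K V P : Type*} [Field K] [AddCommGroup V] [Module K V] [AddTorsor V P]

instance AffineSubspace.finite_of_finite [Finite P] : Finite (AffineSubspace K P) :=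
  Finite.of_injective (fun s : AffineSubspace K P => (s : Set P)) SetLike.coe_injective

open Classical in
/-- The lines of `L` with direction vector `v`. -/
noncomputable def linesAlong [Fintype (AffineSubspace K P)] (L : Set (AffineSubspace K P)) (v : V) :
    Finset (AffineSubspace K P) :=
  {l | l ∈ L ∧ l ∈ parallelClass K P v}

variable [Fintype (AffineSubspace K P)] {L : Set (AffineSubspace K P)} {x : ℕ}

theorem mem_linesAlong {v : V} {l : AffineSubspace K P} :
    l ∈ linesAlong L v ↔ l ∈ L ∧ l ∈ parallelClass K P v := by
  simp [linesAlong]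

theorem IsAffineCameronLiebler.card_linesAlong (hL : IsAffineCameronLiebler L x) {v : V}
    (hv : v ≠ 0) : (linesAlong L v).card = x := by
  have h := hL.encard_inter _ (isAffineLineSpread_parallelClass hv)
  have : L ∩ parallelClass K P v = (linesAlong L v : Set (AffineSubspace K P)) := by
    ext l; simp [mem_linesAlong]
  rw [this, Set.encard_coe_eq_coe_finsetCard] at h
  exact_mod_cast h

open Classical in
/-- Within a flat, a Cameron–Liebler line class has equally many lines in every direction. -/
theorem IsAffineCameronLiebler.card_filter_le_eq (hL : IsAffineCameronLiebler L x) {v w : V}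
    (hv : v ≠ 0) (hw : w ≠ 0) {π : AffineSubspace K P}
    (hvπ : v ∈ π.direction) (hwπ : w ∈ π.direction) :
    ((linesAlong L v).filter (· ≤ π)).card = ((linesAlong L w).filter (· ≤ π)).card := by
  have h := hL.encard_inter _ (isAffineLineSpread_switch hv hw hvπ hwπ)
  have heq : L ∩ ({l | l ∈ parallelClass K P v ∧ ¬ l ≤ π} ∪ {l | l ∈ parallelClass K P w ∧ l ≤ π}) =
      (((linesAlong L v).filter (¬ · ≤ π) ∪ (linesAlong L w).filter (· ≤ π) :
        Finset (AffineSubspace K P)) : Set (AffineSubspace K P)) := by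
    ext l
    simp [mem_linesAlong]
    tauto
  rw [heq, Set.encard_coe_eq_coe_finsetCard, Finset.card_union_of_disjoint] at h
  -- Both spreads meet `L` in `x` lines and share those outside `π`, so the parts inside `π` have
  -- equal size.
  · have h1 := (linesAlong L v).card_filter_add_card_filter_not (· ≤ π)
    rw [hL.card_linesAlong hv] at h1
    have h2 : ((linesAlong L v).filter (¬ · ≤ π)).card +
      ((linesAlong L w).filter (· ≤ π)).card = x := by exact_mod_cast h
    omega
  · rw [Finset.disjoint_left]
    intro l hl hl'
    exact (Finset.mem_filter.1 hl).2 (Finset.mem_filter.1 hl').2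

open Classical in
/-- Counting pairs of parallel lines by the plane that they span. -/
theorem card_offDiag_linesAlong (L : Set (AffineSubspace K P)) {v : V} (hv : v ≠ 0) :
    (linesAlong L v).offDiag.card =
      ∑ π : AffineSubspace K P with Module.finrank K π.direction = 2,
        ((linesAlong L v).filter (· ≤ π)).offDiag.card := by
  rw [Finset.card_eq_sum_card_fiberwise (f := fun a => a.1 ⊔ a.2)
    (t := {π : AffineSubspace K P | Module.finrank K π.direction = 2})]
  · refine Finset.sum_congr rfl fun π hπ => congrArg _ ?_
    have hπ2 := (Finset.mem_filter.1 hπ).2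
    ext ⟨l, m⟩
    simp only [Finset.mem_filter, Finset.mem_offDiag]
    constructor
    · rintro ⟨⟨hl, hm, hne⟩, rfl⟩
      exact ⟨⟨hl, le_sup_left⟩, ⟨hm, le_sup_right⟩, hne⟩
    · rintro ⟨⟨hl, hlπ⟩, ⟨hm, hmπ⟩, hne⟩
      exact ⟨⟨hl, hm, hne⟩, sup_eq_of_parallel_of_le hv (mem_linesAlong.1 hl).2
        (mem_linesAlong.1 hm).2 hne hπ2 hlπ hmπ⟩
  · rintro ⟨l, m⟩ h
    obtain ⟨hl, hm, hne⟩ := Finset.mem_offDiag.1 (Finset.mem_coe.1 h)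
    simpa using finrank_direction_sup_of_parallel hv (mem_linesAlong.1 hl).2
      (mem_linesAlong.1 hm).2 hne

theorem Finset.card_offDiag_eq_two_mul_choose {α : Type*} [DecidableEq α] (s : Finset α) :
    s.offDiag.card = 2 * s.card.choose 2 := by
  rw [Finset.offDiag_card, Nat.choose_two_right,
    Nat.mul_div_cancel' (Nat.even_mul_pred_self _).two_dvd, Nat.mul_sub_one]

open Classical in
theorem card_filter_ne_zero_mem [Fintype V] [Finite K] (U : Submodule K V) :
    (({v | v ≠ 0 ∧ v ∈ U} : Finset V).card : ℤ) =
      (Nat.card K : ℤ) ^ Module.finrank K U - 1 := by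
  have h1 : ({v | v ≠ 0 ∧ v ∈ U} : Finset V) = ({v | v ∈ U} : Finset V).erase 0 := by
    ext v; simp
  have h2 : ({v | v ∈ U} : Finset V).card = Nat.card K ^ Module.finrank K U := by
    rw [← Module.natCard_eq_pow_finrank (K := K) (V := U), Nat.card_eq_fintype_card,
      Fintype.card_subtype]
  have h3 : (0 : V) ∈ ({v | v ∈ U} : Finset V) := by simp
  rw [h1, Finset.card_erase_of_mem h3, Nat.cast_sub (Finset.card_pos.2 ⟨0, h3⟩), h2]
  simp

open Classical in
-- Only the `q^2 - 1` nonzero vectors of `π.direction` contribute, all equally; any one of them,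
-- `w`, supplies `t`.
theorem IsAffineCameronLiebler.sum_offDiag_filter_le [Fintype V] [Finite K]
    (hL : IsAffineCameronLiebler L x) {π : AffineSubspace K P}
    (hπ : Module.finrank K π.direction = 2) :
    ∃ t : ℕ, ((∑ v : V with v ≠ 0, ((linesAlong L v).filter (· ≤ π)).offDiag.card : ℕ) : ℤ) =
      ((Nat.card K : ℤ) ^ 2 - 1) * (2 * t) := by
  have : Nontrivial π.direction := Module.nontrivial_of_finrank_pos (R := K) (by omega)
  obtain ⟨⟨w, hwπ⟩, hw⟩ := exists_ne (0 : π.direction)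
  have hw0 : w ≠ 0 := fun h => hw (by simpa using h)
  refine ⟨((linesAlong L w).filter (· ≤ π)).card.choose 2, ?_⟩
  have hcard := card_filter_ne_zero_mem (K := K) π.direction
  rw [hπ] at hcard
  rw [← hcard]
  have hsub : ({v | v ≠ 0 ∧ v ∈ π.direction} : Finset V) ⊆ ({v | v ≠ 0} : Finset V) := by
    intro v; simp +contextual
  rw [← Finset.sum_subset hsub, Finset.sum_congr rfl (g := fun _ =>
    2 * ((linesAlong L w).filter (· ≤ π)).card.choose 2)]
  · rw [Finset.sum_const, smul_eq_mul]
    push_cast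
    rfl
  · intro v hv
    obtain ⟨hv0, hvπ⟩ := (Finset.mem_filter.1 hv).2
    rw [Finset.card_offDiag_eq_two_mul_choose, hL.card_filter_le_eq hv0 hw0 hvπ hwπ]
  · intro v hv hv'
    have hv0 : v ≠ 0 := by simpa using hv
    rw [Finset.card_eq_zero, Finset.filter_false_of_mem, Finset.offDiag_empty]
    intro l hl hlπ
    refine hv' (Finset.mem_filter.2 ⟨Finset.mem_univ _, hv0, ?_⟩)
    apply AffineSubspace.direction_le hlπ
    rw [(mem_linesAlong.1 hl).2.2]
    exact Submodule.mem_span_singleton_self v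

end Counting

theorem corollary4p3 {K : Type*} [Field K] [Finite K] (q : ℕ) (hq : Nat.card K = q)
    (L : Set (AffineSubspace K (Fin 3 → K))) (x : ℕ) (hL : IsAffineCameronLiebler L x) :
    ((x : ℤ) * ((x : ℤ) - 1)) / 2 ≡ 0 [ZMOD ((q : ℤ) + 1)] := by
  classical
  have := Fintype.ofFinite (AffineSubspace K (Fin 3 → K))
  have := Fintype.ofFinite K
  have hcount : ∀ v : Fin 3 → K, v ≠ 0 → 2 * x.choose 2 =
      ∑ π : AffineSubspace K (Fin 3 → K) with Module.finrank K π.direction = 2,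
        ((linesAlong L v).filter (· ≤ π)).offDiag.card := fun v hv => by
    rw [← card_offDiag_linesAlong L hv, Finset.card_offDiag_eq_two_mul_choose,
      hL.card_linesAlong hv]
  -- Summing over vectors counts each direction `q - 1` times; this common factor cancels in
  -- `hfactor`.
  have hsum : ∑ v : Fin 3 → K with v ≠ 0, 2 * x.choose 2 =
      ∑ π : AffineSubspace K (Fin 3 → K) with Module.finrank K π.direction = 2,
        ∑ v : Fin 3 → K with v ≠ 0, ((linesAlong L v).filter (· ≤ π)).offDiag.card := by
    rw [Finset.sum_comm]
    exact Finset.sum_congr rfl fun v hv => hcount v (Finset.mem_filter.1 hv).2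
  have hdvd : ((q : ℤ) ^ 2 - 1) * 2 ∣ ((q : ℤ) ^ 3 - 1) * (2 * x.choose 2) := by
    have hcard := card_filter_ne_zero_mem (K := K) (⊤ : Submodule K (Fin 3 → K))
    simp only [Submodule.mem_top, and_true, finrank_top, Module.finrank_fin_fun, hq] at hcard
    rw [Finset.sum_const, smul_eq_mul] at hsum
    have hcast := congrArg (Nat.cast : ℕ → ℤ) hsum
    push_cast at hcast
    rw [hcard] at hcast
    rw [hcast]
    refine Finset.dvd_sum fun π hπ => ?_
    obtain ⟨t, ht⟩ := hL.sum_offDiag_filter_le (Finset.mem_filter.1 hπ).2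
    rw [hq] at ht
    push_cast at ht
    exact ⟨t, by rw [mul_assoc]; convert ht⟩
  have hq1 : (1 : ℤ) < q := by
    rw [← hq]
    exact_mod_cast Finite.one_lt_card
  obtain ⟨t, ht⟩ := hdvd
  have hfactor : ((q : ℤ) ^ 2 + q + 1) * x.choose 2 = (q + 1) * t := by
    have h0 : (2 * ((q : ℤ) - 1)) ≠ 0 := by omega
    apply mul_left_cancel₀ h0
    linear_combination ht
  have hx : (x : ℤ) * ((x : ℤ) - 1) / 2 = x.choose 2 := by
    have h := Nat.choose_two_right x
    have h2 := Nat.mul_div_cancel' (Nat.even_mul_pred_self x).two_dvd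
    rw [← h] at h2
    -- In `h2` the subtraction `x - 1` is truncated, so `x = 0` is treated apart.
    rcases x with _ | n
    · simp
    · have h3 : (2 : ℤ) * ((n + 1).choose 2 : ℕ) = ((n + 1 : ℕ) : ℤ) * (((n + 1 : ℕ) : ℤ) - 1) := by
        have := congrArg (Nat.cast : ℕ → ℤ) h2
        push_cast at this ⊢
        simpa using this
      omega
  rw [hx, Int.modEq_zero_iff_dvd]
  -- The witness comes from `q^2 + q + 1 = q * (q + 1) + 1`.
  exact ⟨t - q * x.choose 2, by linear_combination hfactor⟩
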